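/- Let $\mathcal H$ be a separable complex Hilbert space with inner product linear in the second variable. A semispectral measure $E:\mathcal B(\mathbb R)\to L(\mathcal H)$ is a weakly $\sigma$-additive set function with values in the positive bounded operators and $E(\mathbb R)=I$; write $E_{\psi,\varphi}(B)=\langle\psi|E(B)\varphi\rangle$ (a complex measure) and $E_\varphi=E_{\varphi,\varphi}$ (a finite positive measure). For $k\in\mathbb N=\{0,1,2,\dots\}$, the $k$-th moment operator $L(x^k,E)$ is the linear operator whose domain $D(x^k,E)$ consists of the $\varphi\in\mathcal H$ for which $x\mapsto x^k$ is $E_{\psi,\varphi}$-integrable for all $\psi\in\mathcal H$, and which satisfies $\langle\psi|L(x^k,E)\varphi\rangle=\int x^k\,dE_{\psi,\varphi}$ for all $\psi\in\mathcal H$, $\varphi\in D(x^k,E)$. Given semispectral measures $E^n$ ($n\in\mathbb N$) and $E$ and a dense linear subspace $\mathcal D\subset\mathcal H$, call $E$ a moment limit for $(E^n)$ on $\mathcal D$ if $\mathcal D\subset D(x^k,E^n)$ and $\mathcal D\subset D(x^k,E)$ for all $n,k\in\mathbb N$, and $\lim_{n\to\infty}\langle\psi|L(x^k,E^n)\varphi\rangle=\langle\psi|L(x^k,E)\varphi\rangle$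 for all $k\in\mathbb N$, $\psi\in\mathcal H$, $\varphi\in\mathcal D$. Call $E$ $\mathcal D$-determinate if for each $\varphi\in\mathcal D$ all moments of $E_\varphi$ exist and are finite, and $E_\varphi$ is the only finite positive Borel measure on $\mathbb R$ with these moments. Proposition. Let $E^n:\mathcal B(\mathbb R)\to L(\mathcal H)$ be a semispectral measure for each $n\in\mathbb N$. Assume that there is a dense linear subspace $\mathcal D\subset\bigcap_{n,m\in\mathbb N}D(x^m,E^n)$ such that the limit $\lim_{n\to\infty}\langle\varphi|L(x^m,E^n)\varphi\rangle$ exists in $\mathbb R$ for each $m\in\mathbb N$ and $\varphi\in\mathcal D$. (a) There exists a semispectral measure $E:\mathcal B(\mathbb R)\to L(\mathcal H)$ which is a moment limit for $(E^n)_{n\in\mathbb N}$ on $\mathcal D$. (b) Suppose that a moment limit $E$ for $(E^n)_{n\in\mathbb N}$ on $\mathcal D$ is $\mathcal D$-determinate. Then $E$ is the only moment limit for $(E^n)_{n\in\mathbb N}$ on $\mathcal D$, and $(E^n)$ converges to $E$ weakly in the sense of probabilities, i.e. $E^n(B)\to E(B)$ in the weak operator topology for every Borel set $B\subset\mathbb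 R$ with $E(\partial B)=0$. -/

import Mathlib

open MeasureTheory Filter Topology

/-- A semispectral measure (normalized positive operator measure) on a measurable space `Ω` with
values in the bounded operators on `H`: a weakly σ-additive set function `E` on the measurable sets
with `E B ≥ 0` for all `B` and `E Ω = I`. As for Mathlib's `VectorMeasure`, the irrelevant values
at non-measurable sets are set to `0`, so that two semispectral measures are equal
iff they agree on the σ-algebra. -/
@[ext]
structure SemispectralMeasure (Ω : Type*) [MeasurableSpace Ω] (H : Type*)
    [NormedAddCommGroup H] [InnerProductSpace ℂ H] where
  /-- The operator `E B` attached to a set `B`. -/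
  op : Set Ω → (H →L[ℂ] H)
  op_not_measurable : ∀ B : Set Ω, ¬ MeasurableSet B → op B = 0
  op_isPositive : ∀ B : Set Ω, MeasurableSet B → (op B).IsPositive
  op_univ : op Set.univ = ContinuousLinearMap.id ℂ H
  op_iUnion : ∀ B : ℕ → Set Ω, (∀ i, MeasurableSet (B i)) → Pairwise (Function.onFun Disjoint B) →
    ∀ ψ φ : H, HasSum (fun i => inner ℂ ψ (op (B i) φ)) (inner ℂ ψ (op (⋃ i, B i) φ))

namespace SemispectralMeasure

noncomputable section

section General

variable {Ω : Type*} [MeasurableSpace Ω] {H : Type*} [NormedAddCommGroup H]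
  [InnerProductSpace ℂ H] (E : SemispectralMeasure Ω H)

theorem op_empty : E.op ∅ = 0 := by
  ext φ
  refine ext_inner_left ℂ fun ψ => ?_
  have h := E.op_iUnion (fun _ => ∅) (fun _ => MeasurableSet.empty)
    (fun i j _ => by simp [Function.onFun]) ψ φ
  have h0 := h.summable.tendsto_atTop_zero
  have h1 := tendsto_nhds_unique h0 tendsto_const_nhds
  simpa using h1.symm

/-- The complex measure `E_{ψ,φ} : B ↦ ⟨ψ | E B φ⟩`. -/
def scalarMeasure (ψ φ : H) : ComplexMeasure Ω where
  measureOf' B := inner ℂ ψ (E.op B φ)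
  empty' := by simp [E.op_empty]
  not_measurable' B hB := by simp [E.op_not_measurable B hB]
  m_iUnion' B hB hd := E.op_iUnion B hB hd ψ φ

theorem scalarMeasure_apply (ψ φ : H) (B : Set Ω) :
    E.scalarMeasure ψ φ B = inner ℂ ψ (E.op B φ) := rfl

theorem re_inner_nonneg (φ : H) (B : Set Ω) : 0 ≤ (inner ℂ φ (E.op B φ)).re := by
  by_cases hB : MeasurableSet B
  · exact (E.op_isPositive B hB).re_inner_nonneg_right φ
  · simp [E.op_not_measurable B hB]

/-- The finite positive measure `E_φ : B ↦ ⟨φ | E B φ⟩` (a probability measure if `φ` is a unit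
vector). -/
def posMeasure (φ : H) : Measure Ω :=
  Measure.ofMeasurable (fun B _ => ENNReal.ofReal (inner ℂ φ (E.op B φ)).re)
    (by simp [E.op_empty])
    (fun B hB hd => by
      have h := Complex.hasSum_re (E.op_iUnion B hB hd φ φ)
      rw [← h.tsum_eq]
      exact ENNReal.ofReal_tsum_of_nonneg (fun i => E.re_inner_nonneg φ (B i)) h.summable)

theorem posMeasure_apply (φ : H) {B : Set Ω} (hB : MeasurableSet B) :
    E.posMeasure φ B = ENNReal.ofReal (inner ℂ φ (E.op B φ)).re :=
  Measure.ofMeasurable_apply B hB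

theorem scalarMeasure_add (ψ φ φ' : H) :
    E.scalarMeasure ψ (φ + φ') = E.scalarMeasure ψ φ + E.scalarMeasure ψ φ' := by
  ext B _
  simp [scalarMeasure_apply]

theorem scalarMeasure_smul (c : ℂ) (ψ φ : H) :
    E.scalarMeasure ψ (c • φ) = c • E.scalarMeasure ψ φ := by
  ext B _
  simp [scalarMeasure_apply]

/-- The integral `∫ f dE_{ψ,φ}` of a complex function with respect to the complex
measure `E_{ψ,φ}`. -/
def scalarIntegral (f : Ω → ℂ) (ψ φ : H) : ℂ :=
  (E.scalarMeasure ψ φ).integral f (ContinuousLinearMap.mul ℝ ℂ)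

/-- The domain `D(f,E)` of the operator integral: the vectors `φ` such that `f` is integrable with
respect to the complex measure `E_{ψ,φ}` (i.e. with respect to its total variation)
for every `ψ`. -/
def domain (f : Ω → ℂ) : Submodule ℂ H where
  carrier := {φ | ∀ ψ : H, (E.scalarMeasure ψ φ).Integrable f}
  zero_mem' ψ := by
    have : E.scalarMeasure ψ 0 = 0 := by ext B _; simp [scalarMeasure_apply]
    rw [this]
    exact VectorMeasure.Integrable.zero_vectorMeasure
  add_mem' hφ hφ' ψ := by
    rw [scalarMeasure_add]
    exact VectorMeasure.Integrable.add_vectorMeasure (hφ ψ) (hφ' ψ)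
  smul_mem' c φ hφ ψ := by
    show Integrable f (E.scalarMeasure ψ (c • φ)).variation
    rw [scalarMeasure_smul, VectorMeasure.variation_smul]
    exact Integrable.smul_measure_nnreal (hφ ψ)

/-- The operator `∑ c • E (f ⁻¹ {c})` attached to a simple function. -/
def simpleOp (f : SimpleFunc Ω ℂ) : H →L[ℂ] H := ∑ c ∈ f.range, c • E.op (f ⁻¹' {c})

theorem scalarIntegral_simpleFunc (f : SimpleFunc Ω ℂ) (ψ φ : H)
    (hf : (E.scalarMeasure ψ φ).Integrable f) :
    E.scalarIntegral f ψ φ = inner ℂ ψ (E.simpleOp f φ) := by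
  unfold scalarIntegral
  rw [VectorMeasure.integral_eq_setToFun, setToFun_simpleFunc_eq_setToSimpleFunc _ _ hf]
  simp only [SimpleFunc.setToSimpleFunc, simpleOp, sum_apply, inner_sum,
    smul_apply, inner_smul_right]
  rfl

theorem tendsto_simpleOp {f : Ω → ℂ} (hf : Measurable f) {φ : H} (hφ : φ ∈ E.domain f) (ψ : H) :
    Tendsto (fun n => inner ℂ ψ
        (E.simpleOp (SimpleFunc.approxOn f hf Set.univ 0 (Set.mem_univ _) n) φ))
      atTop (𝓝 (E.scalarIntegral f ψ φ)) := by
  have hb : ∀ n x, ‖SimpleFunc.approxOn f hf Set.univ 0 (Set.mem_univ _) n x‖ ≤ ‖f x‖ + ‖f x‖ :=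
    fun n x => SimpleFunc.norm_approxOn_zero_le hf (Set.mem_univ _) x n
  have hint : Integrable (fun x => ‖f x‖ + ‖f x‖) (E.scalarMeasure ψ φ).variation :=
    (hφ ψ).norm.add (hφ ψ).norm
  have key : Tendsto (fun n => E.scalarIntegral
      (SimpleFunc.approxOn f hf Set.univ 0 (Set.mem_univ _) n) ψ φ) atTop
      (𝓝 (E.scalarIntegral f ψ φ)) := by
    refine VectorMeasure.tendsto_integral_of_dominated_convergence (fun x => ‖f x‖ + ‖f x‖)
      (fun n => SimpleFunc.aestronglyMeasurable _) hint
      (fun n => ae_of_all _ (hb n)) (ae_of_all _ fun x => ?_)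
    exact SimpleFunc.tendsto_approxOn hf _ (by simp)
  refine key.congr fun n => E.scalarIntegral_simpleFunc _ ψ φ ?_
  exact hint.mono' (SimpleFunc.aestronglyMeasurable _) (ae_of_all _ (hb n))

variable [CompleteSpace H]

/-- For `φ ∈ D(f,E)` the functional `ψ ↦ ∫ f dE_{ψ,φ}` is represented by a vector. -/
theorem exists_opIntegral {f : Ω → ℂ} (hf : Measurable f) {φ : H} (hφ : φ ∈ E.domain f) :
    ∃ v : H, ∀ ψ : H, inner ℂ ψ v = E.scalarIntegral f ψ φ := by
  let g : ℕ → (H →L[ℂ] ℂ) := fun n => innerSL ℂ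
    (E.simpleOp (SimpleFunc.approxOn f hf Set.univ 0 (Set.mem_univ _) n) φ)
  have hg : Tendsto (fun n ψ => g n ψ) atTop
      (𝓝 (fun ψ => (starRingEnd ℂ) (E.scalarIntegral f ψ φ))) := by
    rw [tendsto_pi_nhds]
    intro ψ
    have h := (Complex.continuous_conj.tendsto _).comp (E.tendsto_simpleOp hf hφ ψ)
    refine h.congr fun n => ?_
    simp [g]
  refine ⟨(InnerProductSpace.toDual ℂ H).symm (continuousLinearMapOfTendsto g hg), fun ψ => ?_⟩
  rw [← inner_conj_symm, InnerProductSpace.toDual_symm_apply]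
  exact Complex.conj_conj _

/-- The operator integral `L(f,E)` of a measurable function `f`: the (not necessarily densely
defined) linear operator with domain `D(f,E)` and
`⟨ψ | L(f,E) φ⟩ = ∫ f dE_{ψ,φ}` for all `ψ : H` and `φ ∈ D(f,E)`. -/
def opIntegral (f : Ω → ℂ) (hf : Measurable f) : H →ₗ.[ℂ] H where
  domain := E.domain f
  toFun :=
    { toFun := fun φ => (E.exists_opIntegral hf φ.2).choose
      map_add' := fun φ φ' => by
        refine ext_inner_left ℂ fun ψ => ?_
        rw [inner_add_right, (E.exists_opIntegral hf (φ + φ').2).choose_spec ψ,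
          (E.exists_opIntegral hf φ.2).choose_spec ψ, (E.exists_opIntegral hf φ'.2).choose_spec ψ]
        refine tendsto_nhds_unique (E.tendsto_simpleOp hf (φ + φ').2 ψ) ?_
        simpa [inner_add_right] using
          (E.tendsto_simpleOp hf φ.2 ψ).add (E.tendsto_simpleOp hf φ'.2 ψ)
      map_smul' := fun c φ => by
        refine ext_inner_left ℂ fun ψ => ?_
        rw [RingHom.id_apply, inner_smul_right, (E.exists_opIntegral hf (c • φ).2).choose_spec ψ,
          (E.exists_opIntegral hf φ.2).choose_spec ψ]
        refine tendsto_nhds_unique (E.tendsto_simpleOp hf (c • φ).2 ψ) ?_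
        simpa [inner_smul_right] using (E.tendsto_simpleOp hf φ.2 ψ).const_mul c }

theorem inner_opIntegral {f : Ω → ℂ} (hf : Measurable f) (ψ : H) (φ : E.domain f) :
    inner ℂ ψ (E.opIntegral f hf φ) = E.scalarIntegral f ψ φ :=
  (E.exists_opIntegral hf φ.2).choose_spec ψ

end General

section RealLine

variable {H : Type*} [NormedAddCommGroup H] [InnerProductSpace ℂ H] [CompleteSpace H]

theorem measurable_monomial (k : ℕ) : Measurable (fun x : ℝ => (x : ℂ) ^ k) := by fun_prop

/-- The `k`-th moment operator `L(x^k, E)`; its domain is `D(x^k, E)`. -/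
def moment (E : SemispectralMeasure ℝ H) (k : ℕ) : H →ₗ.[ℂ] H :=
  E.opIntegral (fun x : ℝ => (x : ℂ) ^ k) (measurable_monomial k)

/-- `E` is a moment limit for the sequence `En` on the dense subspace `D`: the subspace `D` is
contained in the domains of all moment operators of all `En n` and of `E`, and
`⟨ψ | L(x^k, En n) φ⟩ → ⟨ψ | L(x^k, E) φ⟩` for all `k`, all `ψ : H` and all `φ ∈ D`. -/
structure IsMomentLimit (En : ℕ → SemispectralMeasure ℝ H) (E : SemispectralMeasure ℝ H)
    (D : Submodule ℂ H) : Prop where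
  dense : Dense (D : Set H)
  le_domain_seq : ∀ n k, D ≤ ((En n).moment k).domain
  le_domain : ∀ k, D ≤ (E.moment k).domain
  tendsto : ∀ (k : ℕ) (ψ φ : H) (hφ : φ ∈ D),
    Tendsto (fun n => inner ℂ ψ ((En n).moment k ⟨φ, le_domain_seq n k hφ⟩)) atTop
      (𝓝 (inner ℂ ψ (E.moment k ⟨φ, le_domain k hφ⟩)))

/-- A measure on `ℝ` (used for finite measures) is determinate if it has all moments and is the
only finite positive measure with these moments. -/
def _root_.MeasureTheory.Measure.IsDeterminate (μ : Measure ℝ) : Prop :=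
  (∀ k : ℕ, Integrable (fun x : ℝ => x ^ k) μ) ∧
    ∀ ν : Measure ℝ, IsFiniteMeasure ν → (∀ k : ℕ, Integrable (fun x : ℝ => x ^ k) ν) →
      (∀ k : ℕ, ∫ x, x ^ k ∂ν = ∫ x, x ^ k ∂μ) → ν = μ

/-- `E` is `D`-determinate if `E_φ` is determinate for each `φ ∈ D`. -/
def IsDeterminateOn (E : SemispectralMeasure ℝ H) (D : Set H) : Prop :=
  ∀ φ ∈ D, (E.posMeasure φ).IsDeterminate

/-- The sequence `En` converges to `E` weakly in the sense of probabilities: `En n B → E B` in the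
weak operator topology for all Borel sets `B` with `E (∂B) = 0`. -/
def TendstoWeaklyProb (En : ℕ → SemispectralMeasure ℝ H) (E : SemispectralMeasure ℝ H) : Prop :=
  ∀ B : Set ℝ, MeasurableSet B → E.op (frontier B) = 0 →
    Tendsto (fun n => ContinuousLinearMapWOT.ofCLM ((En n).op B)) atTop
      (𝓝 (ContinuousLinearMapWOT.ofCLM (E.op B)))

end RealLine

end

end SemispectralMeasure

/-! Fix an ultrafilter `U` on ℕ finer than `atTop`. For `φ ∈ D` the second moments of the measures
`E^n_φ` are bounded, so by Chebyshev these measures are tight; the parallelogram law carries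
tightness to every `φ`. Prokhorov's theorem then gives weak limits `μ_φ` along `U` for all `φ`
simultaneously. The identities making `φ ↦ E^n_φ` a bounded Hermitian quadratic form survive the
limit, so polarization and Riesz representation turn `μ` into a semispectral measure `E`
(`exists_tendsto_ultrafilter`).

Bounded moments of order `2k` give convergence of the `k`-th moments along `U`. As the moments
converge along the whole sequence by hypothesis, their limits are the moments of `E`. Cauchy–Schwarz
bounds `‖L(x^k, E^n) φ‖` uniformly in `n`, so convergence of the diagonal values on `D` extends by
polarization to `ψ ∈ D` and by density to all `ψ`. Thus `E` is a moment limit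
(`isMomentLimit_of_tendsto_ultrafilter`).

Two moment limits share the moments of `E_φ` for `φ ∈ D`, so determinacy and density force them to
agree. Hence every ultrafilter produces the same `E`, the whole sequence `E^n_φ` converges weakly,
and the portmanteau theorem concludes. -/

open scoped NNReal ENNReal

/-! ### Hermitian quadratic forms and positive operators -/

/-- The identities over nonnegative scalars that characterise `φ ↦ s (φ, φ)` for a bounded Hermitian
sesquilinear form `s`, with values in a module over `ℝ≥0`. -/
structure IsHermitianQuadratic {H M : Type*} [NormedAddCommGroup H] [InnerProductSpace ℂ H]
    [AddCommMonoid M] [Module ℝ≥0 M] (q : H → M) : Prop where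
  add_add : ∀ a b c : H, q (a + b + c) + q a + q b + q c = q (a + b) + q (b + c) + q (a + c)
  smul_add : ∀ (t : ℝ≥0) (a b : H),
    q (((t : ℝ) : ℂ) • a + b) + t • q a + t • q b = t ^ 2 • q a + q b + t • q (a + b)
  I_smul : ∀ a : H, q (Complex.I • a) = q a

namespace IsHermitianQuadratic

section Module

variable {H M : Type*} [NormedAddCommGroup H] [InnerProductSpace ℂ H]
  [AddCommMonoid M] [Module ℝ≥0 M]

/-- The identities are free of subtraction so that they make sense in `FiniteMeasure Ω`; only
addition and nonnegative scaling occur, and both are continuous. -/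
theorem of_tendsto [TopologicalSpace M] [T2Space M] [ContinuousAdd M] [ContinuousConstSMul ℝ≥0 M]
    {ι : Type*} {l : Filter ι} [l.NeBot] {q : ι → H → M} {r : H → M}
    (hq : ∀ i, IsHermitianQuadratic (q i)) (h : ∀ φ, Tendsto (fun i => q i φ) l (𝓝 (r φ))) :
    IsHermitianQuadratic r where
  add_add a b c := by
    refine tendsto_nhds_unique ((((h _).add (h a)).add (h b)).add (h c))
      ((((h (a + b)).add (h (b + c))).add (h (a + c))).congr fun i => ?_)
    exact ((hq i).add_add a b c).symm
  smul_add t a b := by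
    refine tendsto_nhds_unique (((h _).add ((h a).const_smul t)).add ((h b).const_smul t))
      (((((h a).const_smul (t ^ 2)).add (h b)).add ((h (a + b)).const_smul t)).congr fun i => ?_)
    exact ((hq i).smul_add t a b).symm
  I_smul a := by
    refine tendsto_nhds_unique (h _) ((h a).congr fun i => ?_)
    exact ((hq i).I_smul a).symm

end Module

/-- The real polar form of a quadratic form. -/
def polar {H : Type*} [AddCommGroup H] (q : H → ℝ) (x y : H) : ℝ := q (x + y) - q x - q y

theorem polar_comm {H : Type*} [AddCommGroup H] {q : H → ℝ} (x y : H) : polar q x y = polar q y x := by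
  unfold polar
  rw [add_comm x y]
  ring

section Real

variable {H : Type*} [NormedAddCommGroup H] [InnerProductSpace ℂ H]

theorem re_inner_map (T : H →L[ℂ] H) : IsHermitianQuadratic (fun φ : H => (inner ℂ φ (T φ)).re) where
  add_add a b c := by
    simp only [map_add, inner_add_left, inner_add_right, Complex.add_re]
    ring
  smul_add t a b := by
    simp only [map_add, map_smul, inner_add_left, inner_add_right, inner_smul_left,
      inner_smul_right, Complex.add_re, NNReal.smul_def, Complex.conj_ofReal, Complex.re_ofReal_mul,
      smul_eq_mul, NNReal.coe_pow]
    ring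
  I_smul a := by
    simp

variable {q : H → ℝ}

theorem map_zero (hq : IsHermitianQuadratic q) : q 0 = 0 := by
  have := hq.add_add 0 0 0
  simp only [add_zero] at this
  linarith

theorem polar_add_left (hq : IsHermitianQuadratic q) (x x' y : H) :
    polar q (x + x') y = polar q x y + polar q x' y := by
  have := hq.add_add x x' y
  unfold polar
  linarith

theorem polar_neg_left (hq : IsHermitianQuadratic q) (x y : H) : polar q (-x) y = -polar q x y := by
  have h := hq.polar_add_left x (-x) y
  rw [add_neg_cancel] at h
  have h0 : polar q 0 y = 0 := by simp [polar, hq.map_zero]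
  linarith

theorem polar_nnreal_smul_left (hq : IsHermitianQuadratic q) (t : ℝ≥0) (x y : H) :
    polar q (((t : ℝ) : ℂ) • x) y = t * polar q x y := by
  have h1 := hq.smul_add t x y
  -- Taking `b = 0` extracts `q (t x) = t ^ 2 * q x`.
  have h2 := hq.smul_add t x 0
  simp only [NNReal.smul_def, smul_eq_mul, NNReal.coe_pow, add_zero, hq.map_zero, mul_zero] at h1 h2
  unfold polar
  linarith

theorem polar_real_smul_left (hq : IsHermitianQuadratic q) (t : ℝ) (x y : H) :
    polar q ((t : ℂ) • x) y = t * polar q x y := by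
  rcases le_total 0 t with ht | ht
  · simpa [ht] using hq.polar_nnreal_smul_left t.toNNReal x y
  · have h := hq.polar_nnreal_smul_left (-t).toNNReal (-x) y
    rw [hq.polar_neg_left, Real.coe_toNNReal _ (neg_nonneg.mpr ht)] at h
    rw [← neg_neg x, smul_neg, ← neg_smul, ← Complex.ofReal_neg, h, neg_neg]
    ring

theorem polar_I_smul_I_smul (hq : IsHermitianQuadratic q) (x y : H) :
    polar q (Complex.I • x) (Complex.I • y) = polar q x y := by
  simp only [polar, ← _root_.smul_add, hq.I_smul]

theorem polar_I_smul_right (hq : IsHermitianQuadratic q) (x y : H) :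
    polar q x (Complex.I • y) = -polar q (Complex.I • x) y := by
  rw [← hq.polar_I_smul_I_smul, smul_smul, Complex.I_mul_I, neg_one_smul, polar_comm,
    hq.polar_neg_left, polar_comm]

theorem polar_self (hq : IsHermitianQuadratic q) (x : H) : polar q x x = 2 * q x := by
  have h := hq.smul_add 1 x x
  have h2 := hq.smul_add 2 x 0
  simp only [NNReal.smul_def, smul_eq_mul, NNReal.coe_pow, add_zero, hq.map_zero, mul_zero] at h2
  have h3 : ((((2 : ℝ≥0) : ℝ) : ℂ) • x) = x + x := by rw [← two_smul ℂ x]; simp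
  rw [h3] at h2
  simp only [polar]
  push_cast at h2
  linarith

/-- On unit vectors `q (u + v) ∈ [0, 4]` and `q u, q v ∈ [0, 1]`, so the polar form lies in `[-2,
4]`; real homogeneity does the rest. A crude constant suffices, since only continuity is needed. -/
theorem abs_polar_le (hq : IsHermitianQuadratic q) (h0 : ∀ φ, 0 ≤ q φ) (h1 : ∀ φ, q φ ≤ ‖φ‖ ^ 2)
    (x y : H) : |polar q x y| ≤ 4 * ‖x‖ * ‖y‖ := by
  have key : ∀ u v : H, ‖u‖ = 1 → ‖v‖ = 1 → |polar q u v| ≤ 4 := by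
    intro u v hu hv
    have h2 : ‖u + v‖ ≤ 2 := (norm_add_le u v).trans (by linarith)
    have h3 := h1 (u + v)
    have h4 := h1 u
    have h5 := h1 v
    have h6 : ‖u + v‖ ^ 2 ≤ 4 := by nlinarith [norm_nonneg (u + v)]
    rw [hu] at h4
    rw [hv] at h5
    unfold polar
    rw [abs_le]
    constructor <;> linarith [h0 (u + v), h0 u, h0 v]
  have hscale : ∀ z : H, ∃ u : H, (z = 0 ∨ ‖u‖ = 1) ∧ z = ((‖z‖ : ℝ) : ℂ) • u := by
    intro z
    rcases eq_or_ne z 0 with rfl | hz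
    · exact ⟨0, by simp⟩
    · have hz' : ‖z‖ ≠ 0 := norm_ne_zero_iff.mpr hz
      refine ⟨((‖z‖⁻¹ : ℝ) : ℂ) • z, Or.inr ?_, ?_⟩
      · rw [norm_smul]
        simp [hz']
      · rw [smul_smul, ← Complex.ofReal_mul, mul_inv_cancel₀ hz']
        simp
  obtain ⟨u, hu, hxu⟩ := hscale x
  obtain ⟨v, hv, hyv⟩ := hscale y
  have hxy : polar q x y = ‖x‖ * (‖y‖ * polar q u v) := by
    conv_lhs => rw [hxu, hyv]
    rw [hq.polar_real_smul_left, polar_comm, hq.polar_real_smul_left, polar_comm]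
  rw [hxy, abs_mul, abs_mul, abs_norm, abs_norm]
  rcases hu with rfl | hu
  · simp
  rcases hv with rfl | hv
  · simp
  have := mul_le_mul_of_nonneg_left (key u v hu hv) (mul_nonneg (norm_nonneg x) (norm_nonneg y))
  linarith

/-- The sesquilinear form of a Hermitian quadratic form. -/
noncomputable def sesq (q : H → ℝ) (x y : H) : ℂ :=
  ((polar q x y : ℝ) + (polar q (Complex.I • x) y : ℝ) * Complex.I) / 2

theorem sesq_add_left (hq : IsHermitianQuadratic q) (x x' y : H) :
    sesq q (x + x') y = sesq q x y + sesq q x' y := by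
  simp only [sesq, _root_.smul_add, hq.polar_add_left]
  push_cast
  ring

theorem sesq_add_right (hq : IsHermitianQuadratic q) (x y y' : H) :
    sesq q x (y + y') = sesq q x y + sesq q x y' := by
  simp only [sesq, polar_comm _ (y + y'), hq.polar_add_left, polar_comm y, polar_comm y']
  push_cast
  ring

theorem sesq_real_smul_left (hq : IsHermitianQuadratic q) (t : ℝ) (x y : H) :
    sesq q ((t : ℂ) • x) y = t * sesq q x y := by
  simp only [sesq, smul_comm Complex.I (t : ℂ) x, hq.polar_real_smul_left]
  push_cast
  ring

theorem sesq_real_smul_right (hq : IsHermitianQuadratic q) (t : ℝ) (x y : H) :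
    sesq q x ((t : ℂ) • y) = t * sesq q x y := by
  simp only [sesq, polar_comm _ ((t : ℂ) • y), hq.polar_real_smul_left, polar_comm y]
  push_cast
  ring

theorem sesq_I_smul_left (hq : IsHermitianQuadratic q) (x y : H) :
    sesq q (Complex.I • x) y = -Complex.I * sesq q x y := by
  simp only [sesq, smul_smul, Complex.I_mul_I, neg_one_smul, hq.polar_neg_left]
  push_cast
  linear_combination ((polar q (Complex.I • x) y : ℂ) / 2) * Complex.I_mul_I

theorem sesq_I_smul_right (hq : IsHermitianQuadratic q) (x y : H) :
    sesq q x (Complex.I • y) = Complex.I * sesq q x y := by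
  simp only [sesq, hq.polar_I_smul_right, smul_smul, Complex.I_mul_I, neg_one_smul,
    hq.polar_neg_left]
  push_cast
  linear_combination (-(polar q (Complex.I • x) y : ℂ) / 2) * Complex.I_mul_I

theorem sesq_smul_left (hq : IsHermitianQuadratic q) (c : ℂ) (x y : H) :
    sesq q (c • x) y = starRingEnd ℂ c * sesq q x y := by
  conv_lhs => rw [← Complex.re_add_im c, add_smul, mul_smul, hq.sesq_add_left,
    hq.sesq_real_smul_left, hq.sesq_real_smul_left, hq.sesq_I_smul_left]
  have hc : starRingEnd ℂ c = c.re - c.im * Complex.I := by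
    apply Complex.ext <;> simp
  rw [hc]
  ring

theorem sesq_smul_right (hq : IsHermitianQuadratic q) (c : ℂ) (x y : H) :
    sesq q x (c • y) = c * sesq q x y := by
  conv_lhs => rw [← Complex.re_add_im c, add_smul, mul_smul, hq.sesq_add_right,
    hq.sesq_real_smul_right, hq.sesq_real_smul_right, hq.sesq_I_smul_right]
  conv_rhs => rw [← Complex.re_add_im c]
  ring

/-- The imaginary part vanishes because invariance under `I` makes `polar q (I • x) x` its own
negative. -/
theorem sesq_self (hq : IsHermitianQuadratic q) (x : H) : sesq q x x = q x := by
  have h : polar q (Complex.I • x) x = 0 := by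
    have h1 := hq.polar_I_smul_right x x
    rw [polar_comm] at h1
    linarith
  simp [sesq, h, hq.polar_self]

theorem norm_sesq_le (hq : IsHermitianQuadratic q) (h0 : ∀ φ, 0 ≤ q φ) (h1 : ∀ φ, q φ ≤ ‖φ‖ ^ 2)
    (x y : H) : ‖sesq q x y‖ ≤ 4 * ‖x‖ * ‖y‖ := by
  have h2 := hq.abs_polar_le h0 h1 x y
  have h3 := hq.abs_polar_le h0 h1 (Complex.I • x) y
  rw [norm_smul, Complex.norm_I, one_mul] at h3
  have h4 : ‖((polar q x y : ℝ) : ℂ) + (polar q (Complex.I • x) y : ℝ) * Complex.I‖ ≤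
      |polar q x y| + |polar q (Complex.I • x) y| :=
    (norm_add_le _ _).trans (by simp)
  rw [sesq, norm_div, Complex.norm_ofNat]
  linarith

/-- A nonnegative Hermitian quadratic form bounded by the squared norm is the quadratic form of a
positive operator. -/
theorem exists_isPositive [CompleteSpace H] (hq : IsHermitianQuadratic q) (h0 : ∀ φ, 0 ≤ q φ)
    (h1 : ∀ φ, q φ ≤ ‖φ‖ ^ 2) :
    ∃ T : H →L[ℂ] H, T.IsPositive ∧ ∀ φ, inner ℂ φ (T φ) = (q φ : ℂ) := by
  let B : H →L⋆[ℂ] H →L[ℂ] ℂ := LinearMap.mkContinuous₂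
    (LinearMap.mk₂'ₛₗ (starRingEnd ℂ) (RingHom.id ℂ) (sesq q) hq.sesq_add_left hq.sesq_smul_left
      hq.sesq_add_right hq.sesq_smul_right) 4 (hq.norm_sesq_le h0 h1)
  have hB : ∀ φ, inner ℂ (InnerProductSpace.continuousLinearMapOfBilin B φ) φ = (q φ : ℂ) := by
    intro φ
    rw [InnerProductSpace.continuousLinearMapOfBilin_apply]
    exact hq.sesq_self φ
  refine ⟨InnerProductSpace.continuousLinearMapOfBilin B, ?_, fun φ => ?_⟩
  · rw [ContinuousLinearMap.isPositive_iff_complex]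
    intro φ
    rw [hB]
    simpa using h0 φ
  · rw [← inner_conj_symm, hB, Complex.conj_ofReal]

end Real

end IsHermitianQuadratic

/-! ### The finite measures `E_φ` and reconstruction of `E` from them -/

namespace SemispectralMeasure

section FiniteMeasure

variable {Ω : Type*} [MeasurableSpace Ω] {H : Type*} [NormedAddCommGroup H]
  [InnerProductSpace ℂ H] (E : SemispectralMeasure Ω H)

theorem inner_op_self (φ : H) {B : Set Ω} (hB : MeasurableSet B) :
    inner ℂ φ (E.op B φ) = ((inner ℂ φ (E.op B φ)).re : ℂ) := by
  have h := (E.op_isPositive B hB).inner_nonneg_right φ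
  exact Complex.ext rfl (Complex.le_def.mp h).2.symm

theorem posMeasure_real (φ : H) {B : Set Ω} (hB : MeasurableSet B) :
    (E.posMeasure φ).real B = (inner ℂ φ (E.op B φ)).re := by
  rw [measureReal_def, E.posMeasure_apply φ hB, ENNReal.toReal_ofReal (E.re_inner_nonneg φ B)]

theorem ofReal_posMeasure_real (φ : H) {B : Set Ω} (hB : MeasurableSet B) :
    ((E.posMeasure φ).real B : ℂ) = inner ℂ φ (E.op B φ) := by
  rw [E.posMeasure_real φ hB, ← E.inner_op_self φ hB]

theorem posMeasure_univ (φ : H) : E.posMeasure φ Set.univ = ENNReal.ofReal (‖φ‖ ^ 2) := by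
  rw [E.posMeasure_apply φ MeasurableSet.univ, E.op_univ, ContinuousLinearMap.id_apply,
    inner_self_eq_norm_sq_to_K]
  norm_cast

instance isFiniteMeasure_posMeasure (φ : H) : IsFiniteMeasure (E.posMeasure φ) :=
  ⟨by rw [E.posMeasure_univ]; exact ENNReal.ofReal_lt_top⟩

/-- The measure `E_φ` as a finite measure. -/
noncomputable def finMeasure (φ : H) : FiniteMeasure Ω :=
  ⟨E.posMeasure φ, E.isFiniteMeasure_posMeasure φ⟩

theorem toMeasure_finMeasure (φ : H) : (E.finMeasure φ : Measure Ω) = E.posMeasure φ := rfl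

theorem coe_finMeasure_apply (φ : H) {B : Set Ω} (hB : MeasurableSet B) :
    (E.finMeasure φ B : ℝ) = (inner ℂ φ (E.op B φ)).re :=
  E.posMeasure_real φ hB

theorem mass_finMeasure (φ : H) : (E.finMeasure φ).mass = ‖φ‖₊ ^ 2 := by
  rw [← ENNReal.coe_inj, FiniteMeasure.ennreal_mass, toMeasure_finMeasure, E.posMeasure_univ]
  rw [ENNReal.ofReal_pow (norm_nonneg φ), ofReal_norm, ENNReal.coe_pow, enorm_eq_nnnorm]

theorem isHermitianQuadratic_finMeasure : IsHermitianQuadratic E.finMeasure where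
  add_add a b c := by
    refine FiniteMeasure.eq_of_forall_apply_eq _ _ fun B hB => NNReal.eq ?_
    have h := (IsHermitianQuadratic.re_inner_map (E.op B)).add_add a b c
    simpa only [FiniteMeasure.coeFn_add, Pi.add_apply, NNReal.coe_add,
      E.coe_finMeasure_apply _ hB] using h
  smul_add t a b := by
    refine FiniteMeasure.eq_of_forall_apply_eq _ _ fun B hB => NNReal.eq ?_
    have h := (IsHermitianQuadratic.re_inner_map (E.op B)).smul_add t a b
    simpa only [FiniteMeasure.coeFn_add, FiniteMeasure.coeFn_smul, Pi.add_apply, Pi.smul_apply,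
      NNReal.coe_add, smul_eq_mul, NNReal.coe_mul, NNReal.smul_def, NNReal.coe_pow,
      E.coe_finMeasure_apply _ hB] using h
  I_smul a := by
    refine FiniteMeasure.eq_of_forall_apply_eq _ _ fun B hB => NNReal.eq ?_
    have h := (IsHermitianQuadratic.re_inner_map (E.op B)).I_smul a
    simpa only [E.coe_finMeasure_apply _ hB] using h

end FiniteMeasure

section OfFamily

variable {Ω : Type*} [MeasurableSpace Ω] {H : Type*} [NormedAddCommGroup H]
  [InnerProductSpace ℂ H]

/-- The sesquilinear form of an operator is a combination of values of its quadratic form. -/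
theorem inner_map_polarization {V : Submodule ℂ H} (T : V →ₗ[ℂ] H) (x y : V) :
    inner ℂ (x : H) (T y) =
      (inner ℂ ((x + y : V) : H) (T (x + y)) - inner ℂ ((x - y : V) : H) (T (x - y)) -
        Complex.I * inner ℂ ((x + Complex.I • y : V) : H) (T (x + Complex.I • y)) +
        Complex.I * inner ℂ ((x - Complex.I • y : V) : H) (T (x - Complex.I • y))) / 4 := by
  simp only [map_add, map_sub, map_smul, Submodule.coe_add, Submodule.coe_sub, Submodule.coe_smul,
    inner_add_left, inner_add_right, inner_sub_left, inner_sub_right, inner_smul_left,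
    inner_smul_right, Complex.conj_I]
  ring_nf
  simp only [Complex.I_sq]
  ring

theorem inner_clm_polarization (T : H →L[ℂ] H) (x y : H) :
    inner ℂ x (T y) =
      (inner ℂ (x + y) (T (x + y)) - inner ℂ (x - y) (T (x - y)) -
        Complex.I * inner ℂ (x + Complex.I • y) (T (x + Complex.I • y)) +
        Complex.I * inner ℂ (x - Complex.I • y) (T (x - Complex.I • y))) / 4 :=
  inner_map_polarization (V := ⊤) (T.toLinearMap ∘ₗ (⊤ : Submodule ℂ H).subtype) ⟨x, trivial⟩
    ⟨y, trivial⟩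

/-- Continuity extends the equality of diagonal values to all of `H` before polarization is applied,
so `D` need not be a subspace. -/
theorem clm_ext_of_dense {D : Set H} (hD : Dense D) {S T : H →L[ℂ] H}
    (h : ∀ φ ∈ D, inner ℂ φ (S φ) = inner ℂ φ (T φ)) : S = T := by
  have h' : (fun φ => inner ℂ φ (S φ)) = fun φ => inner ℂ φ (T φ) :=
    Continuous.ext_on hD (by fun_prop) (by fun_prop) h
  ext φ
  refine ext_inner_left ℂ fun ψ => ?_
  rw [inner_clm_polarization S, inner_clm_polarization T]
  simp only [fun χ => congrFun h' χ]

theorem ext_of_posMeasure {E F : SemispectralMeasure Ω H} {D : Set H} (hD : Dense D)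
    (h : ∀ φ ∈ D, E.posMeasure φ = F.posMeasure φ) : E = F := by
  ext1
  funext B
  by_cases hB : MeasurableSet B
  · refine clm_ext_of_dense hD fun φ hφ => ?_
    rw [← E.ofReal_posMeasure_real φ hB, ← F.ofReal_posMeasure_real φ hB, h φ hφ]
  · rw [E.op_not_measurable B hB, F.op_not_measurable B hB]

/-- A family of finite measures that depends on the vector as a Hermitian quadratic form comes from
a semispectral measure. -/
theorem exists_finMeasure_eq [CompleteSpace H] {μ : H → FiniteMeasure Ω}
    (hμ : IsHermitianQuadratic μ) (hmass : ∀ φ, (μ φ).mass = ‖φ‖₊ ^ 2) :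
    ∃ E : SemispectralMeasure Ω H, ∀ φ, E.finMeasure φ = μ φ := by
  classical
  have hq : ∀ B : Set Ω, IsHermitianQuadratic (fun φ => (μ φ B : ℝ)) := fun B =>
    { add_add := fun a b c => by
        have h := congrArg (fun ν : FiniteMeasure Ω => (ν B : ℝ)) (hμ.add_add a b c)
        simpa only [FiniteMeasure.coeFn_add, Pi.add_apply, NNReal.coe_add] using h
      smul_add := fun t a b => by
        have h := congrArg (fun ν : FiniteMeasure Ω => (ν B : ℝ)) (hμ.smul_add t a b)
        simpa only [FiniteMeasure.coeFn_add, FiniteMeasure.coeFn_smul, Pi.add_apply, Pi.smul_apply,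
          NNReal.coe_add, smul_eq_mul, NNReal.coe_mul, NNReal.smul_def, NNReal.coe_pow] using h
      I_smul := fun a => by rw [hμ.I_smul] }
  have hle : ∀ (B : Set Ω) (φ : H), (μ φ B : ℝ) ≤ ‖φ‖ ^ 2 := fun B φ => by
    have h := (μ φ).apply_le_mass B
    rw [hmass] at h
    exact_mod_cast h
  choose T hTpos hT using fun B =>
    (hq B).exists_isPositive (fun φ => NNReal.coe_nonneg _) (hle B)
  have hTop : ∀ B, MeasurableSet B → (if MeasurableSet B then T B else 0) = T B :=
    fun B hB => if_pos hB
  let E : SemispectralMeasure Ω H :=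
    { op := fun B => if MeasurableSet B then T B else 0
      op_not_measurable := fun B hB => if_neg hB
      op_isPositive := fun B hB => by rw [hTop B hB]; exact hTpos B
      op_univ := by
        rw [hTop _ MeasurableSet.univ]
        refine clm_ext_of_dense dense_univ fun φ _ => ?_
        have h : μ φ Set.univ = ‖φ‖₊ ^ 2 := hmass φ
        rw [hT, h, ContinuousLinearMap.id_apply, inner_self_eq_norm_sq_to_K]
        norm_cast
      op_iUnion := fun B hB hd ψ φ => by
        simp only [hTop _ (hB _), hTop _ (MeasurableSet.iUnion hB)]
        -- On the diagonal, σ-additivity is that of the measure `μ χ`; polarization then gives the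
        -- off-diagonal case.
        have key : ∀ χ : H, HasSum (fun i => inner ℂ χ (T (B i) χ))
            (inner ℂ χ (T (⋃ i, B i) χ)) := by
          intro χ
          simp only [hT]
          rw [Complex.hasSum_ofReal, NNReal.hasSum_coe, ← ENNReal.hasSum_coe]
          simp only [FiniteMeasure.ennreal_coeFn_eq_coeFn_toMeasure]
          rw [measure_iUnion hd hB]
          exact ENNReal.summable.hasSum
        simp only [fun C => inner_clm_polarization (T C) ψ φ]
        exact ((((key _).sub (key _)).sub ((key _).mul_left _)).add
          ((key _).mul_left _)).div_const 4 }
  refine ⟨E, fun φ => FiniteMeasure.eq_of_forall_apply_eq _ _ fun B hB => NNReal.eq ?_⟩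
  rw [E.coe_finMeasure_apply φ hB]
  have h : E.op B = T B := hTop B hB
  rw [h, hT, Complex.ofReal_re]

end OfFamily

end SemispectralMeasure

/-! ### Weak convergence and integrals of unbounded functions -/

namespace MeasureTheory.FiniteMeasure

/-- Truncation of a function to the interval `[-R, R]`. -/
noncomputable def clip {Ω : Type*} (R : ℝ) (f : Ω → ℝ) (x : Ω) : ℝ := max (-R) (min R (f x))

theorem abs_clip_le {Ω : Type*} {R : ℝ} (hR : 0 ≤ R) (f : Ω → ℝ) (x : Ω) : |clip R f x| ≤ R := by
  unfold clip
  rw [abs_le]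
  exact ⟨le_max_left _ _, max_le (by linarith) (min_le_left _ _)⟩

/-- The truncation error vanishes where `|f| ≤ R`, and elsewhere it is at most `|f|` while `R ≤
|f|`. -/
theorem mul_abs_sub_clip_le {Ω : Type*} {R : ℝ} (hR : 0 ≤ R) (f : Ω → ℝ) (x : Ω) :
    R * |f x - clip R f x| ≤ f x ^ 2 := by
  unfold clip
  rcases le_total R (f x) with h | h
  · rw [min_eq_left h, max_eq_right (by linarith), abs_of_nonneg (by linarith)]
    nlinarith
  · rw [min_eq_right h]
    rcases le_total (-R) (f x) with h' | h'
    · rw [max_eq_right h', sub_self, abs_zero, mul_zero]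
      positivity
    · rw [max_eq_left h', abs_of_nonpos (by linarith)]
      nlinarith

variable {Ω : Type*} [MeasurableSpace Ω] [TopologicalSpace Ω] [OpensMeasurableSpace Ω]
  {ι : Type*} {l : Filter ι} [l.NeBot] {μs : ι → FiniteMeasure Ω} {μ : FiniteMeasure Ω}

/-- Fatou's lemma for the weak convergence of finite measures. -/
theorem lintegral_le_of_tendsto (h : Tendsto μs l (𝓝 μ)) {f : Ω → ℝ≥0} (hf : Continuous f)
    {C : ℝ≥0∞} (hC : ∀ᶠ i in l, ∫⁻ x, f x ∂(μs i : Measure Ω) ≤ C) :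
    ∫⁻ x, f x ∂(μ : Measure Ω) ≤ C := by
  -- The truncations are bounded and continuous, so weak convergence applies to them; Fatou's lemma
  -- then removes the truncation.
  have hb : ∀ R : ℕ, ∫⁻ x, (min (f x) R : ℝ≥0) ∂(μ : Measure Ω) ≤ C := by
    intro R
    let g : BoundedContinuousFunction Ω ℝ≥0 := BoundedContinuousFunction.mkOfBound
      ⟨fun x => min (f x) R, by fun_prop⟩ R (fun x y => by
        rw [NNReal.dist_eq, abs_sub_le_iff]
        have hx : ((min (f x) R : ℝ≥0) : ℝ) ≤ R := by exact_mod_cast min_le_right (f x) (R : ℝ≥0)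
        have hy : ((min (f y) R : ℝ≥0) : ℝ) ≤ R := by exact_mod_cast min_le_right (f y) (R : ℝ≥0)
        have hx0 := NNReal.coe_nonneg (min (f x) R)
        have hy0 := NNReal.coe_nonneg (min (f y) R)
        simp only [ContinuousMap.coe_mk]
        constructor <;> linarith)
    refine le_of_tendsto (tendsto_iff_forall_lintegral_tendsto.mp h g) ?_
    filter_upwards [hC] with i hi
    refine le_trans (lintegral_mono fun x => ?_) hi
    exact ENNReal.coe_le_coe.mpr (min_le_left _ _)
  have hlim : ∀ x, Tendsto (fun R : ℕ => ((min (f x) R : ℝ≥0) : ℝ≥0∞)) atTop (𝓝 (f x)) := by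
    intro x
    refine tendsto_const_nhds.congr' ?_
    obtain ⟨N, hN⟩ := exists_nat_ge (f x)
    filter_upwards [eventually_ge_atTop N] with R hR
    rw [min_eq_left (hN.trans (by exact_mod_cast hR))]
  calc ∫⁻ x, f x ∂(μ : Measure Ω)
      = ∫⁻ x, liminf (fun R : ℕ => ((min (f x) R : ℝ≥0) : ℝ≥0∞)) atTop ∂(μ : Measure Ω) := by
        simp only [fun x => (hlim x).liminf_eq]
    _ ≤ liminf (fun R : ℕ => ∫⁻ x, (min (f x) R : ℝ≥0) ∂(μ : Measure Ω)) atTop :=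
        lintegral_liminf_le fun R => by
          have := hf.measurable
          fun_prop
    _ ≤ C := liminf_le_of_frequently_le' (Frequently.of_forall hb)

theorem integrable_of_lintegral_sq_ne_top {ν : Measure Ω} [IsFiniteMeasure ν] {f : Ω → ℝ}
    (hf : Continuous f) (h : ∫⁻ x, ‖f x‖ₑ ^ 2 ∂ν ≠ ∞) :
    Integrable f ν ∧ Integrable (fun x => f x ^ 2) ν := by
  have h2 : Integrable (fun x => f x ^ 2) ν := by
    refine ⟨(hf.pow 2).measurable.aestronglyMeasurable, ?_⟩
    simp only [HasFiniteIntegral, enorm_pow]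
    exact h.lt_top
  have hm : MemLp f 2 ν := (memLp_two_iff_integrable_sq hf.measurable.aestronglyMeasurable).mpr h2
  exact ⟨hm.integrable one_le_two, h2⟩

/-- The bound depends on the measure only through `C`, so truncation is uniform along a family with
bounded second moments. -/
theorem abs_integral_sub_integral_clip_le {ν : Measure Ω} [IsFiniteMeasure ν] {f : Ω → ℝ}
    (hf : Continuous f) {C : ℝ≥0} (h : ∫⁻ x, ‖f x‖ₑ ^ 2 ∂ν ≤ C) {R : ℝ} (hR : 0 < R) :
    |∫ x, f x ∂ν - ∫ x, clip R f x ∂ν| ≤ C / R := by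
  obtain ⟨h1, h2⟩ := integrable_of_lintegral_sq_ne_top hf (h.trans_lt ENNReal.coe_lt_top).ne
  have hc : Continuous (clip R f) := by unfold clip; fun_prop
  have h3 : Integrable (clip R f) ν := Integrable.of_bound hc.measurable.aestronglyMeasurable R
    (ae_of_all _ fun x => abs_clip_le hR.le f x)
  rw [← integral_sub h1 h3]
  have hsq : ∫ x, f x ^ 2 ∂ν ≤ C := by
    rw [integral_eq_lintegral_of_nonneg_ae (ae_of_all _ fun x => sq_nonneg (f x))
      h2.aestronglyMeasurable]
    refine ENNReal.toReal_le_coe_of_le_coe (le_trans (le_of_eq ?_) h)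
    refine lintegral_congr fun x => ?_
    rw [← enorm_pow, Real.enorm_of_nonneg (sq_nonneg _)]
  calc |∫ x, (f x - clip R f x) ∂ν| ≤ ∫ x, |f x - clip R f x| ∂ν := abs_integral_le_integral_abs
    _ ≤ ∫ x, f x ^ 2 / R ∂ν := by
        refine integral_mono (h1.sub h3).abs (h2.div_const R) fun x => ?_
        rw [le_div_iff₀ hR, mul_comm]
        exact mul_abs_sub_clip_le hR.le f x
    _ = (∫ x, f x ^ 2 ∂ν) / R := integral_div _ _
    _ ≤ C / R := by gcongr

/-- Under weak convergence, the integrals of a continuous function with bounded second moments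
converge. -/
theorem tendsto_integral_of_lintegral_sq_le (h : Tendsto μs l (𝓝 μ)) {f : Ω → ℝ}
    (hf : Continuous f) {C : ℝ≥0} (hC : ∀ i, ∫⁻ x, ‖f x‖ₑ ^ 2 ∂(μs i : Measure Ω) ≤ C) :
    ∫⁻ x, ‖f x‖ₑ ^ 2 ∂(μ : Measure Ω) ≤ C ∧
      Tendsto (fun i => ∫ x, f x ∂(μs i : Measure Ω)) l (𝓝 (∫ x, f x ∂(μ : Measure Ω))) := by
  have hμ : ∫⁻ x, ‖f x‖ₑ ^ 2 ∂(μ : Measure Ω) ≤ C :=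
    lintegral_le_of_tendsto (f := fun x => ‖f x‖₊ ^ 2) h (by fun_prop)
      (Eventually.of_forall fun i => by simpa [enorm_eq_nnnorm] using hC i) |>.trans' (by
        simp [enorm_eq_nnnorm])
  refine ⟨hμ, ?_⟩
  rw [Metric.tendsto_nhds]
  intro ε hε
  obtain ⟨R, hR, hCR⟩ : ∃ R : ℝ, 0 < R ∧ C / R < ε / 3 := by
    -- With this `R`, `C / R = (ε / 3) * C / (C + 1) < ε / 3`; the `+ 1` also covers `C = 0`.
    refine ⟨3 * (C + 1) / ε, by positivity, ?_⟩
    have hC0 : (0 : ℝ) ≤ C := C.2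
    rw [div_div_eq_mul_div, div_lt_iff₀ (by positivity)]
    nlinarith
  let g : BoundedContinuousFunction Ω ℝ := BoundedContinuousFunction.ofNormedAddCommGroup
    (clip R f) (by unfold clip; fun_prop) R (abs_clip_le hR.le f)
  have hg := tendsto_iff_forall_integral_tendsto.mp h g
  filter_upwards [Metric.tendsto_nhds.mp hg (ε / 3) (by positivity)] with i hi
  have h1 := abs_integral_sub_integral_clip_le hf (hC i) hR
  have h2 := abs_integral_sub_integral_clip_le hf hμ hR
  have h3 : |∫ x, clip R f x ∂(μs i : Measure Ω) - ∫ x, clip R f x ∂(μ : Measure Ω)| < ε / 3 := hi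
  rw [Real.dist_eq]
  rw [abs_le] at h1 h2
  rw [abs_lt] at h3 ⊢
  constructor <;> linarith

end MeasureTheory.FiniteMeasure

/-! ### Cauchy–Schwarz for `E_{ψ,φ}` and bounds on moment operators -/

namespace SemispectralMeasure

section ScalarMeasure

variable {Ω : Type*} [MeasurableSpace Ω] {H : Type*} [NormedAddCommGroup H]
  [InnerProductSpace ℂ H] (E : SemispectralMeasure Ω H)

/-- Expand the nonnegative form at `ψ - c u φ`, where the unimodular `u` makes the cross term real
and nonnegative. -/
theorem _root_.ContinuousLinearMap.IsPositive.two_mul_norm_inner_le {T : H →L[ℂ] H}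
    (hT : T.IsPositive) (c : ℝ) (ψ φ : H) :
    2 * c * ‖inner ℂ ψ (T φ)‖ ≤ (inner ℂ ψ (T ψ)).re + c ^ 2 * (inner ℂ φ (T φ)).re := by
  obtain ⟨u, hu, huw⟩ : ∃ u : ℂ, ‖u‖ = 1 ∧ u * inner ℂ ψ (T φ) = ‖inner ℂ ψ (T φ)‖ := by
    rcases eq_or_ne (inner ℂ ψ (T φ)) 0 with h | h
    · exact ⟨1, by simp, by simp [h]⟩
    · have h' : (‖inner ℂ ψ (T φ)‖ : ℂ) ≠ 0 := by simpa using h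
      refine ⟨starRingEnd ℂ (inner ℂ ψ (T φ)) / ‖inner ℂ ψ (T φ)‖, ?_, ?_⟩
      · rw [norm_div, RCLike.norm_conj, Complex.norm_real, norm_norm, div_self (by simpa using h)]
      · rw [div_mul_eq_mul_div, mul_comm, Complex.mul_conj, Complex.normSq_eq_norm_sq]
        field_simp
        push_cast
        ring
  have h := hT.re_inner_nonneg_right (ψ - ((c : ℂ) * u) • φ)
  have hsymm : inner ℂ φ (T ψ) = starRingEnd ℂ (inner ℂ ψ (T φ)) := by
    rw [inner_conj_symm]
    exact (hT.isSymmetric φ ψ).symm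
  have huu : starRingEnd ℂ u * u = 1 := by
    rw [mul_comm, Complex.mul_conj, Complex.normSq_eq_norm_sq, hu]
    simp
  have huw' : starRingEnd ℂ u * starRingEnd ℂ (inner ℂ ψ (T φ)) = ‖inner ℂ ψ (T φ)‖ := by
    rw [← map_mul, huw, Complex.conj_ofReal]
  have hexp : inner ℂ (ψ - ((c : ℂ) * u) • φ) (T (ψ - ((c : ℂ) * u) • φ)) =
      inner ℂ ψ (T ψ) + ((c ^ 2 : ℝ) : ℂ) * inner ℂ φ (T φ) -
        ((2 * c * ‖inner ℂ ψ (T φ)‖ : ℝ) : ℂ) := by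
    simp only [map_sub, map_smul, inner_sub_left, inner_sub_right, inner_smul_left,
      inner_smul_right, hsymm, map_mul, Complex.conj_ofReal]
    push_cast
    linear_combination (-(c : ℂ)) * huw - c * huw' + (c : ℂ) ^ 2 * inner ℂ φ (T φ) * huu
  rw [hexp] at h
  simp only [RCLike.re_to_complex, Complex.sub_re, Complex.add_re, Complex.re_ofReal_mul,
    Complex.ofReal_re] at h
  linarith

/-- This form of Cauchy–Schwarz has a right side additive in the set, so a setwise bound passes
directly to the total variation. -/
theorem smul_variation_scalarMeasure_le (c : ℝ≥0) (ψ φ : H) :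
    c • (E.scalarMeasure ψ φ).variation ≤ E.posMeasure ψ + c ^ 2 • E.posMeasure φ := by
  have hc : c • (E.scalarMeasure ψ φ).variation =
      (((c : ℝ) : ℂ) • E.scalarMeasure ψ φ).variation := by
    rw [VectorMeasure.variation_smul]
    simp
  rw [hc]
  refine VectorMeasure.variation_le_of_forall_enorm_le fun B hB => ?_
  have h := (E.op_isPositive B hB).two_mul_norm_inner_le c ψ φ
  have h0 : 0 ≤ (c : ℝ) * ‖inner ℂ ψ (E.op B φ)‖ := by positivity
  rw [Measure.add_apply, Measure.smul_apply, E.posMeasure_apply ψ hB, E.posMeasure_apply φ hB,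
    ENNReal.smul_def, smul_eq_mul, smul_apply, enorm_smul, scalarMeasure_apply,
    ← ofReal_norm, ← ofReal_norm, ← ENNReal.ofReal_coe_nnreal,
    ← ENNReal.ofReal_mul (norm_nonneg _), ← ENNReal.ofReal_mul (NNReal.coe_nonneg _),
    ← ENNReal.ofReal_add (E.re_inner_nonneg ψ B)
      (mul_nonneg (NNReal.coe_nonneg _) (E.re_inner_nonneg φ B))]
  refine ENNReal.ofReal_le_ofReal ?_
  have hcn : ‖((c : ℝ) : ℂ)‖ = c := by simp
  rw [NNReal.coe_pow]
  erw [hcn]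
  linarith

/-- The Cauchy–Schwarz inequality for `E_{ψ,φ}`, in additive form. -/
theorem lintegral_variation_scalarMeasure_le (ψ φ : H) (f : Ω → ℝ≥0∞) :
    ∫⁻ x, f x ∂(E.scalarMeasure ψ φ).variation ≤
      ENNReal.ofReal (‖ψ‖ ^ 2) + ∫⁻ x, f x ^ 2 ∂(E.posMeasure φ) := by
  rw [lintegral_eq_nnreal, ← E.posMeasure_univ]
  -- On each level set of a simple minorant, the free constant in the previous bound is chosen to be
  -- the value taken there.
  refine iSup₂_le fun s hs => ?_
  rw [SimpleFunc.map_lintegral]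
  calc ∑ c ∈ s.range, (c : ℝ≥0∞) * (E.scalarMeasure ψ φ).variation (s ⁻¹' {c})
      ≤ ∑ c ∈ s.range, (E.posMeasure ψ (s ⁻¹' {c}) + (c : ℝ≥0∞) ^ 2 * E.posMeasure φ (s ⁻¹' {c})) :=
        Finset.sum_le_sum fun c _ => by
          have h := E.smul_variation_scalarMeasure_le c ψ φ (s ⁻¹' {c})
          simpa only [Measure.add_apply, Measure.smul_apply, ENNReal.smul_def, smul_eq_mul,
            ENNReal.coe_pow] using h
    _ = E.posMeasure ψ Set.univ + ∫⁻ x, (s x : ℝ≥0∞) ^ 2 ∂(E.posMeasure φ) := by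
        rw [Finset.sum_add_distrib, s.sum_range_measure_preimage_singleton,
          ← SimpleFunc.map_lintegral (fun c : ℝ≥0 => (c : ℝ≥0∞) ^ 2), ← SimpleFunc.lintegral_eq_lintegral]
        rfl
    _ ≤ _ := by
        gcongr with x
        exact hs x

theorem mem_domain_of_lintegral_sq {f : Ω → ℂ} (hf : Measurable f) {φ : H}
    (h : ∫⁻ x, ‖f x‖ₑ ^ 2 ∂(E.posMeasure φ) ≠ ∞) : φ ∈ E.domain f := by
  intro ψ
  refine ⟨hf.aestronglyMeasurable, ?_⟩
  exact (E.lintegral_variation_scalarMeasure_le ψ φ fun x => ‖f x‖ₑ).trans_lt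
    (ENNReal.add_lt_top.mpr ⟨ENNReal.ofReal_lt_top, h.lt_top⟩)

theorem norm_scalarIntegral_le (f : Ω → ℂ) {φ : H} {C : ℝ≥0}
    (h : ∫⁻ x, ‖f x‖ₑ ^ 2 ∂(E.posMeasure φ) ≤ C) (ψ : H) :
    ‖E.scalarIntegral f ψ φ‖ ≤ ‖ψ‖ ^ 2 + C := by
  have h1 := VectorMeasure.norm_integral_le_lintegral_norm (μ := E.scalarMeasure ψ φ) (f := f)
    (B := ContinuousLinearMap.mul ℝ ℂ)
  have h2 : ∫⁻ x, ENNReal.ofReal ‖f x‖ ∂(E.scalarMeasure ψ φ).variation ≤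
      ENNReal.ofReal (‖ψ‖ ^ 2 + C) := by
    rw [ENNReal.ofReal_add (by positivity) C.coe_nonneg, ENNReal.ofReal_coe_nnreal]
    simp only [ofReal_norm]
    exact (E.lintegral_variation_scalarMeasure_le ψ φ _).trans (by gcongr)
  refine h1.trans ?_
  calc _ ≤ 1 * ENNReal.toReal (∫⁻ x, ENNReal.ofReal ‖f x‖ ∂(E.scalarMeasure ψ φ).variation) := by
        gcongr
        exact ContinuousLinearMap.opNorm_mul_le ℝ ℂ
    _ ≤ _ := by
        rw [one_mul]
        exact ENNReal.toReal_le_of_le_ofReal (by positivity) h2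

theorem posMeasure_le_variation (φ : H) : E.posMeasure φ ≤ (E.scalarMeasure φ φ).variation := by
  refine Measure.le_intro fun B hB _ => ?_
  rw [E.posMeasure_apply φ hB]
  refine le_trans ?_ (VectorMeasure.enorm_measure_le_variation _ B)
  rw [scalarMeasure_apply, ← ofReal_norm]
  exact ENNReal.ofReal_le_ofReal (Complex.re_le_norm _)

theorem integrable_posMeasure {f : Ω → ℂ} {φ : H} (hφ : φ ∈ E.domain f) :
    Integrable f (E.posMeasure φ) :=
  Integrable.mono_measure (hφ φ) (E.posMeasure_le_variation φ)

/-- The same simple approximations, dominated by `2‖f‖`, compute both integrals. -/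
theorem scalarIntegral_self {f : Ω → ℂ} (hf : Measurable f) {φ : H} (hφ : φ ∈ E.domain f) :
    E.scalarIntegral f φ φ = ∫ x, f x ∂(E.posMeasure φ) := by
  have hint := E.integrable_posMeasure hφ
  refine tendsto_nhds_unique (E.tendsto_simpleOp hf hφ φ) ?_
  have hL := tendsto_integral_of_dominated_convergence (μ := E.posMeasure φ)
    (F := fun n => SimpleFunc.approxOn f hf Set.univ 0 (Set.mem_univ _) n) (f := f)
    (fun x => ‖f x‖ + ‖f x‖) (fun n => SimpleFunc.aestronglyMeasurable _)
    (hint.norm.add hint.norm)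
    (fun n => ae_of_all _ fun x => SimpleFunc.norm_approxOn_zero_le hf (Set.mem_univ _) x n)
    (ae_of_all _ fun x => SimpleFunc.tendsto_approxOn hf _ (by simp))
  refine hL.congr fun n => ?_
  set s := SimpleFunc.approxOn f hf Set.univ 0 (Set.mem_univ _) n
  have hs : Integrable s (E.posMeasure φ) := (hint.norm.add hint.norm).mono'
    (SimpleFunc.aestronglyMeasurable _)
    (ae_of_all _ fun x => SimpleFunc.norm_approxOn_zero_le hf (Set.mem_univ _) x n)
  rw [← SimpleFunc.integral_eq_integral s hs, SimpleFunc.integral_eq]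
  simp only [simpleOp, sum_apply, inner_sum, smul_apply,
    inner_smul_right]
  refine Finset.sum_congr rfl fun c _ => ?_
  rw [← E.ofReal_posMeasure_real φ (s.measurableSet_fiber c), mul_comm]
  simp

end ScalarMeasure

section Moment

variable {H : Type*} [NormedAddCommGroup H] [InnerProductSpace ℂ H] [CompleteSpace H]
  (E : SemispectralMeasure ℝ H)

theorem integrable_pow {k : ℕ} {φ : H} (hφ : φ ∈ (E.moment k).domain) :
    Integrable (fun x : ℝ => x ^ k) (E.posMeasure φ) := by
  have h := (E.integrable_posMeasure (f := fun x : ℝ => (x : ℂ) ^ k) hφ).re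
  exact h.congr (ae_of_all _ fun x => by simp [← Complex.ofReal_pow])

theorem inner_moment_self {k : ℕ} (φ : (E.moment k).domain) :
    inner ℂ (φ : H) (E.moment k φ) = ((∫ x, x ^ k ∂(E.posMeasure (φ : H)) : ℝ) : ℂ) := by
  have h1 : inner ℂ (φ : H) (E.moment k φ) = E.scalarIntegral (fun x : ℝ => (x : ℂ) ^ k) φ φ :=
    E.inner_opIntegral (measurable_monomial k) φ φ
  rw [h1, E.scalarIntegral_self (measurable_monomial k) φ.2]
  simp only [← Complex.ofReal_pow]
  exact integral_ofReal

theorem mem_moment_domain {k : ℕ} {φ : H} (h : ∫⁻ x, ‖x ^ k‖ₑ ^ 2 ∂(E.posMeasure φ) ≠ ∞) :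
    φ ∈ (E.moment k).domain := by
  refine E.mem_domain_of_lintegral_sq (measurable_monomial k) ?_
  simpa [enorm_pow, ← ofReal_norm] using h

theorem norm_moment_le {k : ℕ} (φ : (E.moment k).domain) {C : ℝ≥0}
    (h : ∫⁻ x, ‖x ^ k‖ₑ ^ 2 ∂(E.posMeasure (φ : H)) ≤ C) : ‖E.moment k φ‖ ≤ 1 + C := by
  have h' : ∫⁻ x : ℝ, ‖(x : ℂ) ^ k‖ₑ ^ 2 ∂(E.posMeasure (φ : H)) ≤ C := by
    simpa [enorm_pow, ← ofReal_norm] using h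
  set v := E.moment k φ with hv
  have hin : ∀ ψ : H, ‖inner ℂ ψ v‖ ≤ ‖ψ‖ ^ 2 + C := fun ψ => by
    have h1 : inner ℂ ψ v = E.scalarIntegral (fun x : ℝ => (x : ℂ) ^ k) ψ φ :=
      E.inner_opIntegral (measurable_monomial k) ψ φ
    rw [h1]
    exact E.norm_scalarIntegral_le _ h' ψ
  rcases eq_or_ne v 0 with h0 | h0
  · rw [h0, norm_zero]
    positivity
  · have hn : ‖v‖ ≠ 0 := norm_ne_zero_iff.mpr h0
    -- Testing against the unit vector in the direction of `v` turns `‖ψ‖ ^ 2 + C` into `1 + C`.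
    have h2 := hin (((‖v‖⁻¹ : ℝ) : ℂ) • v)
    rw [inner_smul_left, inner_self_eq_norm_sq_to_K, norm_smul] at h2
    have e1 : ‖(‖v‖⁻¹ : ℝ)‖ = ‖v‖⁻¹ := by simp
    simp only [Complex.conj_ofReal, norm_mul, Complex.norm_real, e1, inv_mul_cancel₀ hn, one_pow,
      norm_pow, RCLike.norm_ofReal, abs_norm] at h2
    rw [pow_two, ← mul_assoc, inv_mul_cancel₀ hn, one_mul] at h2
    exact h2

theorem lintegral_enorm_pow_sq {k : ℕ} {φ : H} (hφ : φ ∈ (E.moment (2 * k)).domain) :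
    ∫⁻ x, ‖x ^ k‖ₑ ^ 2 ∂(E.posMeasure φ) =
      ENNReal.ofReal (∫ x, x ^ (2 * k) ∂(E.posMeasure φ)) := by
  rw [ofReal_integral_eq_lintegral_ofReal (E.integrable_pow hφ)
    (ae_of_all _ fun x => (even_two_mul k).pow_nonneg x)]
  refine lintegral_congr fun x => ?_
  rw [← enorm_pow, ← pow_mul, mul_comm k 2, Real.enorm_of_nonneg ((even_two_mul k).pow_nonneg x)]

end Moment

end SemispectralMeasure

/-! ### Tightness and limits along ultrafilters -/

namespace SemispectralMeasure

section Compactness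

variable {H : Type*} [NormedAddCommGroup H] [InnerProductSpace ℂ H]

/-- The parallelogram law for `φ - χ` and `χ`. It transfers tail estimates from `D` to arbitrary
vectors, uniformly over all semispectral measures. -/
theorem posMeasure_real_le {Ω : Type*} [MeasurableSpace Ω] (E : SemispectralMeasure Ω H)
    (φ χ : H) {B : Set Ω} (hB : MeasurableSet B) :
    (E.posMeasure φ).real B ≤ 2 * (E.posMeasure χ).real B + 2 * ‖φ - χ‖ ^ 2 := by
  have h1 : (E.posMeasure (φ - χ)).real B ≤ ‖φ - χ‖ ^ 2 := by
    refine (measureReal_mono (Set.subset_univ B)).trans (le_of_eq ?_)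
    rw [measureReal_def, E.posMeasure_univ, ENNReal.toReal_ofReal (by positivity)]
  have h2 : (E.posMeasure φ).real B + (E.posMeasure (φ - χ - χ)).real B =
      2 * (E.posMeasure (φ - χ)).real B + 2 * (E.posMeasure χ).real B := by
    simp only [E.posMeasure_real _ hB, map_sub, inner_sub_left, inner_sub_right, Complex.sub_re]
    ring
  have h3 : 0 ≤ (E.posMeasure (φ - χ - χ)).real B := measureReal_nonneg
  linarith

/-- Chebyshev's inequality for the second moment. -/
theorem posMeasure_real_compl_closedBall_le (E : SemispectralMeasure ℝ H) {φ : H} {C : ℝ≥0}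
    (h : ∫⁻ x, ‖x ^ 1‖ₑ ^ 2 ∂(E.posMeasure φ) ≤ C) {R : ℝ} (hR : 0 < R) :
    (E.posMeasure φ).real (Metric.closedBall 0 R)ᶜ ≤ C / R ^ 2 := by
  have h1 := (mul_meas_ge_le_lintegral (μ := E.posMeasure φ)
    (f := fun x : ℝ => ‖x ^ 1‖ₑ ^ 2) (by fun_prop) (ENNReal.ofReal (R ^ 2))).trans h
  have h2 : (Metric.closedBall (0 : ℝ) R)ᶜ ⊆ {x : ℝ | ENNReal.ofReal (R ^ 2) ≤ ‖x ^ 1‖ₑ ^ 2} := by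
    intro x hx
    rw [Set.mem_compl_iff, mem_closedBall_zero_iff, not_le] at hx
    rw [Set.mem_ofPred_eq, pow_one, ← ofReal_norm, ← ENNReal.ofReal_pow (norm_nonneg x)]
    exact ENNReal.ofReal_le_ofReal (by gcongr)
  have h3 : ENNReal.ofReal (R ^ 2) * E.posMeasure φ (Metric.closedBall 0 R)ᶜ ≤ C :=
    le_trans (by gcongr) h1
  have h4 := ENNReal.toReal_mono ENNReal.coe_ne_top h3
  rw [ENNReal.toReal_mul, ENNReal.toReal_ofReal (by positivity)] at h4
  rw [le_div_iff₀ (by positivity), mul_comm]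
  exact h4

variable {En : ℕ → SemispectralMeasure ℝ H} {D : Set H}

theorem exists_closedBall_compl_le (hD : Dense D)
    (hC : ∀ φ ∈ D, ∃ C : ℝ≥0, ∀ n, ∫⁻ x, ‖x ^ 1‖ₑ ^ 2 ∂((En n).posMeasure φ) ≤ C)
    (φ : H) {ε : ℝ} (hε : 0 < ε) :
    ∃ R : ℝ, ∀ n, ((En n).posMeasure φ).real (Metric.closedBall 0 R)ᶜ ≤ ε := by
  obtain ⟨χ, hχ, hφχ⟩ : ∃ χ ∈ D, ‖φ - χ‖ ^ 2 < ε / 4 := by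
    have ho : IsOpen {χ : H | ‖φ - χ‖ ^ 2 < ε / 4} := isOpen_lt (by fun_prop) continuous_const
    obtain ⟨χ, h1, h2⟩ := hD.inter_open_nonempty _ ho ⟨φ, by simpa using hε⟩
    exact ⟨χ, h2, h1⟩
  obtain ⟨C, hC⟩ := hC χ hχ
  have hlim : Tendsto (fun R : ℝ => (C : ℝ) / R ^ 2) atTop (𝓝 0) :=
    tendsto_const_nhds.div_atTop (tendsto_pow_atTop two_ne_zero)
  obtain ⟨R, hR, hR0⟩ := ((hlim.eventually_lt_const (show 0 < ε / 4 by positivity)).and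
    (eventually_gt_atTop 0)).exists
  refine ⟨R, fun n => ?_⟩
  have h1 := (En n).posMeasure_real_le φ χ (Metric.isClosed_closedBall (x := (0 : ℝ))
    (ε := R)).measurableSet.compl
  have h2 := (En n).posMeasure_real_compl_closedBall_le (hC n) hR0
  linarith

/-- Prokhorov: the total mass is `‖φ‖ ^ 2` for every `n`, and the tails outside suitable balls are
at most `1 / (k + 1)` uniformly in `n`. -/
theorem exists_tendsto_finMeasure (hD : Dense D)
    (hC : ∀ φ ∈ D, ∃ C : ℝ≥0, ∀ n, ∫⁻ x, ‖x ^ 1‖ₑ ^ 2 ∂((En n).posMeasure φ) ≤ C)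
    (U : Ultrafilter ℕ) (φ : H) :
    ∃ μ : FiniteMeasure ℝ, Tendsto (fun n => (En n).finMeasure φ) U (𝓝 μ) := by
  have hu : ∀ k : ℕ, 0 < (1 / ((k : ℝ) + 1)) := fun k => by positivity
  choose R hR using fun k => exists_closedBall_compl_le hD hC φ (hu k)
  have hcomp := isCompact_setOfPred_finiteMeasure_mass_le_compl_isCompact_le (E := ℝ)
    (u := fun k => (1 / ((k : ℝ) + 1)).toNNReal) (K := fun k => Metric.closedBall 0 (R k))
    (‖φ‖₊ ^ 2) (by
      have := (continuous_real_toNNReal.tendsto 0).comp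
        (tendsto_one_div_add_atTop_nhds_zero_nat (𝕜 := ℝ))
      simpa [Function.comp_def] using this)
    (fun k => isCompact_closedBall _ _) (Or.inl inferInstance)
  obtain ⟨μ, -, hμ⟩ := hcomp.ultrafilter_le_nhds' (U.map fun n => (En n).finMeasure φ) (by
    refine Filter.mem_map.mpr (Filter.univ_mem' fun n => ⟨((En n).mass_finMeasure φ).le, fun k => ?_⟩)
    rw [← NNReal.coe_le_coe, Real.coe_toNNReal _ (hu k).le]
    exact hR k n)
  exact ⟨μ, hμ⟩

variable [CompleteSpace H]

/-- One ultrafilter serves all `φ` at once, so the quadratic identities relating different vectors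
pass to the limit. -/
theorem exists_tendsto_ultrafilter (hD : Dense D)
    (hC : ∀ φ ∈ D, ∃ C : ℝ≥0, ∀ n, ∫⁻ x, ‖x ^ 1‖ₑ ^ 2 ∂((En n).posMeasure φ) ≤ C)
    (U : Ultrafilter ℕ) :
    ∃ E : SemispectralMeasure ℝ H,
      ∀ φ, Tendsto (fun n => (En n).finMeasure φ) U (𝓝 (E.finMeasure φ)) := by
  choose μ hμ using exists_tendsto_finMeasure hD hC U
  obtain ⟨E, hE⟩ := exists_finMeasure_eq
    (IsHermitianQuadratic.of_tendsto (fun n => (En n).isHermitianQuadratic_finMeasure) hμ)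
    (fun φ => tendsto_nhds_unique (hμ φ).mass
      (by simp only [mass_finMeasure]; exact tendsto_const_nhds))
  exact ⟨E, fun φ => by rw [hE]; exact hμ φ⟩

end Compactness

/-! ### From diagonal values on a dense subspace to weak convergence -/

section DenseConvergence

variable {H : Type*} [NormedAddCommGroup H] [InnerProductSpace ℂ H]

theorem tendsto_inner_of_dense {V : Set H} (hV : Dense V) {v : ℕ → H} {w : H} {C : ℝ}
    (hC : ∀ n, ‖v n‖ ≤ C)
    (h : ∀ ψ ∈ V, Tendsto (fun n => inner ℂ ψ (v n)) atTop (𝓝 (inner ℂ ψ w))) (ψ : H) :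
    Tendsto (fun n => inner ℂ ψ (v n)) atTop (𝓝 (inner ℂ ψ w)) := by
  rw [Metric.tendsto_nhds]
  intro ε hε
  have hK : 0 < |C| + ‖w‖ + 1 := by positivity
  obtain ⟨χ, hχ, hψχ⟩ := hV.exists_dist_lt ψ (show 0 < ε / (2 * (|C| + ‖w‖ + 1)) by positivity)
  rw [dist_eq_norm, lt_div_iff₀ (by positivity)] at hψχ
  filter_upwards [Metric.tendsto_nhds.mp (h χ hχ) (ε / 2) (by positivity)] with n hn
  rw [dist_eq_norm] at hn ⊢
  -- The second term is small uniformly in `n` because the norms `‖v n‖` are bounded.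
  have h1 : inner ℂ ψ (v n) - inner ℂ ψ w =
      (inner ℂ χ (v n) - inner ℂ χ w) + inner ℂ (ψ - χ) (v n - w) := by
    simp only [inner_sub_left, inner_sub_right]
    ring
  have h2 : ‖v n - w‖ ≤ |C| + ‖w‖ + 1 := by
    linarith [norm_sub_le (v n) w, hC n, le_abs_self C]
  have h3 : ‖inner ℂ (ψ - χ) (v n - w)‖ ≤ ‖ψ - χ‖ * (|C| + ‖w‖ + 1) :=
    (norm_inner_le_norm _ _).trans (by gcongr)
  rw [h1]
  refine (norm_add_le _ _).trans_lt ?_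
  linarith

/-- The restriction of a partially defined operator to a subspace of its domain. -/
def restrictDomain (A : H →ₗ.[ℂ] H) {V : Submodule ℂ H} (hV : V ≤ A.domain) : V →ₗ[ℂ] H :=
  A.toFun ∘ₗ Submodule.inclusion hV

theorem restrictDomain_apply (A : H →ₗ.[ℂ] H) {V : Submodule ℂ H} (hV : V ≤ A.domain) (x : V) :
    restrictDomain A hV x = A ⟨x, hV x.2⟩ := rfl

theorem tendsto_inner_map_of_self {V : Submodule ℂ H} {T : ℕ → V →ₗ[ℂ] H} {S : V →ₗ[ℂ] H}
    (h : ∀ x : V, Tendsto (fun n => inner ℂ (x : H) (T n x)) atTop (𝓝 (inner ℂ (x : H) (S x))))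
    (x y : V) : Tendsto (fun n => inner ℂ (x : H) (T n y)) atTop (𝓝 (inner ℂ (x : H) (S y))) := by
  rw [inner_map_polarization S x y]
  refine Tendsto.congr (fun n => (inner_map_polarization (T n) x y).symm) ?_
  exact ((((h _).sub (h _)).sub ((h _).const_mul _)).add ((h _).const_mul _)).div_const 4

end DenseConvergence

/-! ### Existence and uniqueness of moment limits -/

section MomentLimit

variable {H : Type*} [NormedAddCommGroup H] [InnerProductSpace ℂ H] [CompleteSpace H]
  {En : ℕ → SemispectralMeasure ℝ H} {D : Submodule ℂ H}

/-- The integral is the moment of order `2 * k`, and a convergent sequence is bounded. -/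
theorem exists_forall_lintegral_le (hdom : ∀ n m : ℕ, D ≤ ((En n).moment m).domain)
    (hlim : ∀ (m : ℕ) (φ : H) (hφ : φ ∈ D), ∃ r : ℝ,
      Tendsto (fun n => inner ℂ φ ((En n).moment m ⟨φ, hdom n m hφ⟩)) atTop (𝓝 (r : ℂ)))
    (k : ℕ) {φ : H} (hφ : φ ∈ D) :
    ∃ C : ℝ≥0, ∀ n, ∫⁻ x, ‖x ^ k‖ₑ ^ 2 ∂((En n).posMeasure φ) ≤ C := by
  obtain ⟨r, hr⟩ := hlim (2 * k) φ hφ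
  have hr' := (Complex.continuous_re.tendsto _).comp hr
  obtain ⟨b, hb⟩ := hr'.bddAbove_range
  refine ⟨b.toNNReal, fun n => ?_⟩
  rw [(En n).lintegral_enorm_pow_sq (hdom n (2 * k) hφ)]
  refine ENNReal.ofReal_le_ofReal ?_
  have h := hb (Set.mem_range_self n)
  simpa [(En n).inner_moment_self ⟨φ, hdom n (2 * k) hφ⟩] using h

/-- A weak limit along an ultrafilter of measures with convergent moments is a moment limit. -/
theorem isMomentLimit_of_tendsto_ultrafilter (hD : Dense (D : Set H))
    (hdom : ∀ n m : ℕ, D ≤ ((En n).moment m).domain)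
    (hlim : ∀ (m : ℕ) (φ : H) (hφ : φ ∈ D), ∃ r : ℝ,
      Tendsto (fun n => inner ℂ φ ((En n).moment m ⟨φ, hdom n m hφ⟩)) atTop (𝓝 (r : ℂ)))
    {U : Ultrafilter ℕ} (hU : (U : Filter ℕ) ≤ atTop) {E : SemispectralMeasure ℝ H}
    (hE : ∀ φ, Tendsto (fun n => (En n).finMeasure φ) U (𝓝 (E.finMeasure φ))) :
    IsMomentLimit En E D := by
  have hbound := fun k φ hφ => exists_forall_lintegral_le hdom hlim k (φ := φ) hφ
  have hED : ∀ k, D ≤ (E.moment k).domain := by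
    intro k φ hφ
    obtain ⟨C, hC⟩ := hbound k φ hφ
    refine E.mem_moment_domain ((FiniteMeasure.tendsto_integral_of_lintegral_sq_le (hE φ)
      (f := fun x : ℝ => x ^ k) (by fun_prop) hC).1.trans_lt ENNReal.coe_lt_top).ne
  have hdiag : ∀ k (φ : H) (hφ : φ ∈ D),
      Tendsto (fun n => inner ℂ φ ((En n).moment k ⟨φ, hdom n k hφ⟩)) atTop
        (𝓝 (inner ℂ φ (E.moment k ⟨φ, hED k hφ⟩))) := by
    intro k φ hφ
    obtain ⟨C, hC⟩ := hbound k φ hφ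
    obtain ⟨r, hr⟩ := hlim k φ hφ
    have h1 := (FiniteMeasure.tendsto_integral_of_lintegral_sq_le (hE φ)
      (f := fun x : ℝ => x ^ k) (by fun_prop) hC).2
    have h2 := (Complex.continuous_ofReal.tendsto _).comp h1
    -- Along `U` the moments converge both to that of `E` and to `r`; identifying the two upgrades
    -- convergence along `U` to convergence along the whole sequence.
    have h3 : inner ℂ φ (E.moment k ⟨φ, hED k hφ⟩) = (r : ℂ) := by
      rw [E.inner_moment_self ⟨φ, hED k hφ⟩]
      refine tendsto_nhds_unique h2 ((hr.mono_left hU).congr fun n => ?_)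
      rw [(En n).inner_moment_self ⟨φ, hdom n k hφ⟩]
      rfl
    rw [h3]
    exact hr
  refine ⟨hD, fun n k => hdom n k, hED, fun k ψ φ hφ => ?_⟩
  obtain ⟨C, hC⟩ := hbound k φ hφ
  refine tendsto_inner_of_dense hD (C := 1 + C) 
    (fun n => (En n).norm_moment_le ⟨φ, hdom n k hφ⟩ (hC n)) ?_ ψ
  intro χ hχ
  have key := tendsto_inner_map_of_self (T := fun n => restrictDomain ((En n).moment k) (hdom n k))
    (S := restrictDomain (E.moment k) (hED k))
    (fun x => by simpa only [restrictDomain_apply] using hdiag k x x.2) ⟨χ, hχ⟩ ⟨φ, hφ⟩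
  simpa only [restrictDomain_apply] using key

theorem IsMomentLimit.tendsto_integral {E : SemispectralMeasure ℝ H} (hE : IsMomentLimit En E D)
    (k : ℕ) {φ : H} (hφ : φ ∈ D) :
    Tendsto (fun n => ∫ x, x ^ k ∂((En n).posMeasure φ)) atTop
      (𝓝 (∫ x, x ^ k ∂(E.posMeasure φ))) := by
  have h := (Complex.continuous_re.tendsto _).comp (hE.tendsto k φ φ hφ)
  rw [E.inner_moment_self ⟨φ, hE.le_domain k hφ⟩, Complex.ofReal_re] at h
  refine h.congr fun n => ?_
  simp [(En n).inner_moment_self ⟨φ, hE.le_domain_seq n k hφ⟩]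

/-- For `φ ∈ D`, both measures have as moments the limits of the same sequences, so determinacy
identifies them; density of `D` then gives the operators. -/
theorem IsMomentLimit.eq_of_isDeterminateOn {E E' : SemispectralMeasure ℝ H}
    (hE : IsMomentLimit En E D) (hE' : IsMomentLimit En E' D) (hdet : E.IsDeterminateOn D) :
    E' = E :=
  ext_of_posMeasure hE.dense fun φ hφ => (hdet φ hφ).2 _ inferInstance
    (fun k => E'.integrable_pow (hE'.le_domain k hφ))
    (fun k => tendsto_nhds_unique (hE'.tendsto_integral k hφ) (hE.tendsto_integral k hφ))

end MomentLimit

/-! ### Weak convergence in the sense of probabilities -/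

section WeakConvergence

variable {H : Type*} [NormedAddCommGroup H] [InnerProductSpace ℂ H]
  {En : ℕ → SemispectralMeasure ℝ H} {E : SemispectralMeasure ℝ H}

/-- For a unit vector the measures are probabilities, and the portmanteau theorem applies since `E
(∂B) = 0` makes the boundary null for `E_φ`. -/
theorem tendsto_inner_self_of_norm_eq_one {φ : H} (hφ : ‖φ‖ = 1)
    (h : Tendsto (fun n => (En n).finMeasure φ) atTop (𝓝 (E.finMeasure φ))) {B : Set ℝ}
    (hB : MeasurableSet B) (hfr : E.op (frontier B) = 0) :
    Tendsto (fun n => inner ℂ φ ((En n).op B φ)) atTop (𝓝 (inner ℂ φ (E.op B φ))) := by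
  have hprob : ∀ F : SemispectralMeasure ℝ H, IsProbabilityMeasure (F.posMeasure φ) := fun F =>
    ⟨by rw [F.posMeasure_univ, hφ]; simp⟩
  let P : SemispectralMeasure ℝ H → ProbabilityMeasure ℝ := fun F => ⟨F.posMeasure φ, hprob F⟩
  have hP : Tendsto (fun n => P (En n)) atTop (𝓝 (P E)) :=
    (ProbabilityMeasure.tendsto_nhds_iff_toFiniteMeasure_tendsto_nhds _).mpr h
  have hnull : (P E : Measure ℝ) (frontier B) = 0 := by
    change E.posMeasure φ (frontier B) = 0
    rw [E.posMeasure_apply φ isClosed_frontier.measurableSet, hfr]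
    simp
  have h1 := (ENNReal.tendsto_toReal (measure_ne_top (P E : Measure ℝ) B)).comp
    (ProbabilityMeasure.tendsto_measure_of_null_frontier_of_tendsto' hP hnull)
  have h2 := (Complex.continuous_ofReal.tendsto _).comp h1
  rw [← E.ofReal_posMeasure_real φ hB]
  refine h2.congr fun n => ?_
  rw [← (En n).ofReal_posMeasure_real φ hB]
  rfl

theorem tendstoWeaklyProb_of_tendsto_finMeasure [CompleteSpace H]
    (h : ∀ φ, Tendsto (fun n => (En n).finMeasure φ) atTop (𝓝 (E.finMeasure φ))) :
    TendstoWeaklyProb En E := by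
  intro B hB hfr
  have key : ∀ χ : H, Tendsto (fun n => inner ℂ χ ((En n).op B χ)) atTop
      (𝓝 (inner ℂ χ (E.op B χ))) := by
    intro χ
    rcases eq_or_ne χ 0 with rfl | hχ
    · simp
    · have hn : (‖χ‖ : ℂ) ≠ 0 := by simpa using hχ
      set u : H := (‖χ‖ : ℂ)⁻¹ • χ
      have hu : ‖u‖ = 1 := by simp [u, norm_smul, hχ]
      have hχu : χ = (‖χ‖ : ℂ) • u := by simp [u, smul_smul, hn]
      have h1 := tendsto_inner_self_of_norm_eq_one hu (h u) hB hfr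
      rw [hχu]
      simp only [map_smul, inner_smul_left, inner_smul_right]
      exact (h1.const_mul _).const_mul _
  rw [ContinuousLinearMapWOT.tendsto_iff_forall_inner_apply_tendsto]
  intro φ ψ
  change Tendsto (fun n => inner ℂ ψ ((En n).op B φ)) atTop (𝓝 (inner ℂ ψ (E.op B φ)))
  simp only [fun T : H →L[ℂ] H => inner_clm_polarization T ψ φ]
  exact ((((key _).sub (key _)).sub ((key _).const_mul _)).add ((key _).const_mul _)).div_const 4

end WeakConvergence

end SemispectralMeasure

/-! ### The proposition -/

theorem proposition3 {H : Type*} [NormedAddCommGroup H] [InnerProductSpace ℂ H] [CompleteSpace H]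
    [TopologicalSpace.SeparableSpace H]
    (En : ℕ → SemispectralMeasure ℝ H) (D : Submodule ℂ H) (hD : Dense (D : Set H))
    (hdom : ∀ n m : ℕ, D ≤ ((En n).moment m).domain)
    (hlim : ∀ (m : ℕ) (φ : H) (hφ : φ ∈ D), ∃ r : ℝ,
      Tendsto (fun n => inner ℂ φ ((En n).moment m ⟨φ, hdom n m hφ⟩)) atTop (𝓝 (r : ℂ))) :
    (∃ E : SemispectralMeasure ℝ H, SemispectralMeasure.IsMomentLimit En E D) ∧
    ∀ E : SemispectralMeasure ℝ H, SemispectralMeasure.IsMomentLimit En E D →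
      E.IsDeterminateOn D →
      (∀ E' : SemispectralMeasure ℝ H, SemispectralMeasure.IsMomentLimit En E' D → E' = E) ∧
      SemispectralMeasure.TendstoWeaklyProb En E := by
  have hlimit : ∀ U : Ultrafilter ℕ, (U : Filter ℕ) ≤ atTop →
      ∃ E : SemispectralMeasure ℝ H, SemispectralMeasure.IsMomentLimit En E D ∧
        ∀ φ, Tendsto (fun n => (En n).finMeasure φ) U (𝓝 (E.finMeasure φ)) := by
    intro U hU
    obtain ⟨E, hE⟩ := SemispectralMeasure.exists_tendsto_ultrafilter hD (fun φ hφ =>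
      SemispectralMeasure.exists_forall_lintegral_le hdom hlim 1 hφ) U
    exact ⟨E, SemispectralMeasure.isMomentLimit_of_tendsto_ultrafilter hD hdom hlim hU hE, hE⟩
  refine ⟨?_, fun E hE hdet => ⟨fun E' hE' => hE.eq_of_isDeterminateOn hE' hdet, ?_⟩⟩
  · obtain ⟨E, hE, -⟩ := hlimit (Ultrafilter.of atTop) (Ultrafilter.of_le atTop)
    exact ⟨E, hE⟩
  · refine SemispectralMeasure.tendstoWeaklyProb_of_tendsto_finMeasure fun φ => ?_
    -- Each ultrafilter has its own limit `E'`, but this is a moment limit and so equals `E` by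
    -- uniqueness.
    rw [tendsto_iff_ultrafilter]
    intro U hU
    obtain ⟨E', hE', hlim'⟩ := hlimit U hU
    rw [← hE.eq_of_isDeterminateOn hE' hdet]
    exact hlim' φ
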